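/- Let $k\ge 3$ and $r$ be integers with $0<r<k/2$. For an integer $n\ge 1$, let $A(n)$ be the number of partitions of $n$ all of whose parts are $\equiv \pm r$ or $\equiv 0 \pmod k$ and which satisfy the following conditions, where $L$ denotes the largest odd multiple of $k$ occurring as a part, with the convention $L=0$ if no odd multiple of $k$ occurs: - the parts $\equiv \pm r \pmod k$ are distinct (multiples of $k$ may be repeated); - every odd multiple of $k$ from $k$ to $L$ occurs at least once as a part; - the largest occurring even multiple of $k$ (if any) is at most $L+k$; - the largest occurring part $\equiv r \pmod k$ (if any) is smaller than $L/2$; - the largest occurring part $\equiv -r \pmod k$ (if any) is smaller than $k/2+L/2$. Let $B(n)$ be the number of partitions of $n$ all of whose parts are $\equiv \pm(k+r)$ or $\equiv \pm k \pmod{3k}$, where the parts $\equiv \pm (k+r) \pmod{3k}$ are distinct and the parts $\equiv \pm k \pmod{3k}$ may be repeated. Then $A(n)=B(n)$ for all integers $n\ge 1$. -/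

import Mathlib

/-- `i` is an odd multiple of `k`. -/
def IsOddMultiple (k i : ℕ) : Prop := k ∣ i ∧ Odd (i / k)

/-- `i` is an even multiple of `k`. -/
def IsEvenMultiple (k i : ℕ) : Prop := k ∣ i ∧ Even (i / k)

instance (k : ℕ) : DecidablePred (IsOddMultiple k) := fun i => by
  unfold IsOddMultiple; infer_instance

instance (k : ℕ) : DecidablePred (IsEvenMultiple k) := fun i => by
  unfold IsEvenMultiple; infer_instance

/-- `i ≡ a` or `i ≡ -a` modulo `m`. -/
def CongrPM (m a i : ℕ) : Prop := (i : ℤ) ≡ (a : ℤ) [ZMOD m] ∨ (i : ℤ) ≡ -(a : ℤ) [ZMOD m]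

instance (m a : ℕ) : DecidablePred (CongrPM m a) := fun i => by
  unfold CongrPM; infer_instance

/-- The largest odd multiple of `k` occurring as a part of `p`, taken to be `0` if there is none. -/
def largestOddMultiple (k : ℕ) {n : ℕ} (p : n.Partition) : ℕ :=
  (p.parts.filter (IsOddMultiple k)).sup

/-- The partitions counted by `A(n)`: every part is `≡ ±r` or `≡ 0` modulo `k`, parts `≡ ±r` are not
repeated, and the conditions on the multiples of `k` and on the sizes of the parts `≡ ±r` hold. -/
def IsTypeA (k r : ℕ) {n : ℕ} (p : n.Partition) : Prop :=
  (∀ i ∈ p.parts, CongrPM k r i ∨ k ∣ i) ∧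
  (∀ i ∈ p.parts, CongrPM k r i → p.parts.count i = 1) ∧
  (∀ m ≤ largestOddMultiple k p, IsOddMultiple k m → m ∈ p.parts) ∧
  (∀ i ∈ p.parts, IsEvenMultiple k i → i ≤ largestOddMultiple k p + k) ∧
  (∀ i ∈ p.parts, (i : ℤ) ≡ (r : ℤ) [ZMOD k] → (i : ℚ) < (largestOddMultiple k p : ℚ) / 2) ∧
  (∀ i ∈ p.parts, (i : ℤ) ≡ -(r : ℤ) [ZMOD k] →
    (i : ℚ) < (k : ℚ) / 2 + (largestOddMultiple k p : ℚ) / 2)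

instance (k r n : ℕ) : DecidablePred (IsTypeA k r (n := n)) := fun p => by
  unfold IsTypeA; infer_instance

/-- The partitions counted by `B(n)`: every part is `≡ ±(k + r)` or `≡ ±k` modulo `3k`, and parts
`≡ ±(k + r)` are not repeated. -/
def IsTypeB (k r : ℕ) {n : ℕ} (p : n.Partition) : Prop :=
  (∀ i ∈ p.parts, CongrPM (3 * k) (k + r) i ∨ CongrPM (3 * k) k i) ∧
  (∀ i ∈ p.parts, CongrPM (3 * k) (k + r) i → p.parts.count i = 1)

instance (k r n : ℕ) : DecidablePred (IsTypeB k r (n := n)) := fun p => by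
  unfold IsTypeB; infer_instance

/-- `A(n)`, for the parameters `k` and `r`. -/
def countA (k r n : ℕ) : ℕ := (Finset.univ.filter (fun p : n.Partition => IsTypeA k r p)).card

/-- `B(n)`, for the parameters `k` and `r`. -/
def countB (k r n : ℕ) : ℕ := (Finset.univ.filter (fun p : n.Partition => IsTypeB k r p)).card

/-! Put x = X^r, y = X^(k-r) and q = xy = X^k. Sorting the partitions counted by A according to L =
(2m-1)k, with m = 0 for L = 0, gives the generating function ∑ q^(m²) (-x; q)_m (-y; q)_m / (q;
q)_{2m}: one forced copy of each odd multiple of k up to L weighs q^(1+3+…+(2m-1)) = q^(m²), further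
multiples of k up to L + k give 1/(q; q)_{2m}, and the size bounds leave exactly m candidates in
each class ±r. The generating function for B is the product (-x²y; q³)_∞ (-xy²; q³)_∞ (q³; q³)_∞ /
(q; q)_∞.

The two agree by Bailey's lemma. The finite triple product (`IsInvPoch.finite_triple_product_symm`)
expands (-x; q)_m (-y; q)_m / (q; q)_{2m} in theta terms; summing against q^(m²) multiplies the j-th
term by q^(j²) (`IsInvPoch.sum_bailey`), which turns the terms of f(x, y) into those of f(x²y, xy²)
(`thetaTerm_cubic`). A second triple product, in base q³, sums the latter.

No infinite sums or products occur: the identities are finite, and `X_pow_dvd_sum_sub_prod` compares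
both sides modulo X^(N+1). Partitions enter through `card_partition_eq_coeff`. -/

/-! ### Finite `q`-series identities

Throughout, `c : ℕ → R` is the sequence of inverses of the `q`-Pochhammer symbols `(q; q)_n`,
characterised by `c 0 = 1` and `(1 - q ^ (n + 1)) * c (n + 1) = c n`. -/

section QSeries

variable {R : Type*} [CommRing R]

/-- The `q`-Pochhammer symbol `(q; q)_n`. -/
def qPoch (q : R) (n : ℕ) : R := ∏ i ∈ Finset.range n, (1 - q ^ (i + 1))

/-- The extension by zero of a sequence to the integers. -/
def extendZero (c : ℕ → R) (j : ℤ) : R := if 0 ≤ j then c j.toNat else 0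

theorem extendZero_natCast (c : ℕ → R) (n : ℕ) : extendZero c n = c n := by
  simp [extendZero]

theorem extendZero_of_neg (c : ℕ → R) {j : ℤ} (hj : j < 0) : extendZero c j = 0 := by
  simp [extendZero, hj]

/-- `c` is the sequence of inverses of the `q`-Pochhammer symbols `(q; q)_n`. -/
structure IsInvPoch (q : R) (c : ℕ → R) : Prop where
  zero : c 0 = 1
  succ : ∀ n, (1 - q ^ (n + 1)) * c (n + 1) = c n

theorem qPoch_succ (q : R) (n : ℕ) : qPoch q (n + 1) = qPoch q n * (1 - q ^ (n + 1)) := by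
  simp [qPoch, Finset.prod_range_succ]

theorem IsInvPoch.qPoch_mul {q : R} {c : ℕ → R} (hc : IsInvPoch q c) (n : ℕ) :
    qPoch q n * c n = 1 := by
  induction n with
  | zero => simp [qPoch, hc.zero]
  | succ n ih => rw [qPoch_succ, mul_assoc, hc.succ, ih]

/-- For j ≤ 0 the truncation `j.toNat = 0` makes the factor vanish, so the defining recurrence
survives at the boundary without a side condition. -/
theorem IsInvPoch.extendZero_sub_one {q : R} {c : ℕ → R} (hc : IsInvPoch q c) (j : ℤ) :
    extendZero c (j - 1) = (1 - q ^ j.toNat) * extendZero c j := by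
  rcases lt_or_ge 0 j with hj | hj
  · obtain ⟨n, rfl⟩ : ∃ n : ℕ, j = (n + 1 : ℕ) := ⟨(j - 1).toNat, by omega⟩
    rw [extendZero_natCast, show ((n + 1 : ℕ) : ℤ) - 1 = (n : ℕ) by push_cast; ring,
      extendZero_natCast, Int.toNat_natCast, hc.succ]
  · rw [extendZero_of_neg _ (by omega), Int.toNat_of_nonpos hj]
    simp

/-- The Gaussian binomial coefficient `[n, j]`, zero unless `0 ≤ j ≤ n`. -/
def gaussBinom (q : R) (c : ℕ → R) (n : ℕ) (j : ℤ) : R :=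
  qPoch q n * (extendZero c j * extendZero c (n - j))

theorem gaussBinom_of_neg (q : R) (c : ℕ → R) (n : ℕ) {j : ℤ} (hj : j < 0) :
    gaussBinom q c n j = 0 := by
  simp [gaussBinom, extendZero_of_neg c hj]

theorem gaussBinom_of_lt (q : R) (c : ℕ → R) (n : ℕ) {j : ℤ} (hj : n < j) :
    gaussBinom q c n j = 0 := by
  simp [gaussBinom, extendZero_of_neg c (sub_neg.2 hj)]

theorem gaussBinom_symm (q : R) (c : ℕ → R) (n : ℕ) (j : ℤ) :
    gaussBinom q c n (n - j) = gaussBinom q c n j := by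
  simp only [gaussBinom, sub_sub_cancel, mul_comm]

/-- The q-Pascal rule. Over the common factor (q; q)_n c_j c_{n+1-j} it is the splitting 1 - q^(n+1)
= (1 - q^j) + q^j (1 - q^(n+1-j)). -/
theorem IsInvPoch.gaussBinom_succ {q : R} {c : ℕ → R} (hc : IsInvPoch q c) (n : ℕ) (j : ℤ) :
    gaussBinom q c (n + 1) j = gaussBinom q c n (j - 1) + q ^ j.toNat * gaussBinom q c n j := by
  by_cases hj : 0 ≤ j ∧ j ≤ n + 1
  · have h1 := hc.extendZero_sub_one j
    have h2 := hc.extendZero_sub_one (n + 1 - j)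
    have h3 : q ^ (n + 1) = q ^ j.toNat * q ^ ((n : ℤ) + 1 - j).toNat := by
      rw [← pow_add]; congr 1; omega
    rw [show (n : ℤ) + 1 - j - 1 = n - j by ring] at h2
    simp only [gaussBinom, qPoch_succ]
    rw [show (n : ℤ) - (j - 1) = n + 1 - j by ring, h1, h2, h3]
    push_cast
    ring
  · rcases not_and_or.1 hj with hj | hj
    · rw [gaussBinom_of_neg _ _ _ (by omega), gaussBinom_of_neg _ _ _ (by omega),
        gaussBinom_of_neg _ _ _ (by omega)]
      simp
    · rw [gaussBinom_of_lt _ _ _ (by push_cast; omega), gaussBinom_of_lt _ _ _ (by omega),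
        gaussBinom_of_lt _ _ _ (by omega)]
      simp

theorem IsInvPoch.gaussBinom_succ' {q : R} {c : ℕ → R} (hc : IsInvPoch q c) (n : ℕ) (j : ℤ) :
    gaussBinom q c (n + 1) j =
      gaussBinom q c n j + q ^ ((n : ℤ) + 1 - j).toNat * gaussBinom q c n (j - 1) := by
  rw [← gaussBinom_symm, hc.gaussBinom_succ, ← gaussBinom_symm q c n j,
    ← gaussBinom_symm q c n (j - 1)]
  push_cast
  ring_nf

/-! ### Theta terms and the finite triple product -/

/-- Triangular numbers indexed by the integers. -/
def triangular (j : ℤ) : ℕ := (j * (j + 1) / 2).toNat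

theorem two_mul_triangular (j : ℤ) : 2 * (triangular j : ℤ) = j * (j + 1) := by
  have h : 0 ≤ j * (j + 1) := by
    rcases lt_or_ge j 0 with h | h
    · exact mul_nonneg_of_nonpos_of_nonpos h.le (by omega)
    · positivity
  rw [triangular, Int.toNat_of_nonneg (by omega)]
  exact Int.mul_ediv_cancel' (Int.even_mul_succ_self j).two_dvd

theorem triangular_add_one (j : ℤ) : (triangular (j + 1) : ℤ) = triangular j + (j + 1) := by
  linarith [two_mul_triangular j, two_mul_triangular (j + 1)]

theorem triangular_eq_sub_one (j : ℤ) : (triangular j : ℤ) = triangular (j - 1) + j := by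
  simpa using triangular_add_one (j - 1)

theorem triangular_add_triangular (j : ℤ) :
    triangular j + triangular (j - 1) = j.natAbs ^ 2 := by
  zify
  rw [sq_abs]
  linarith [two_mul_triangular j, two_mul_triangular (j - 1)]

/-- The general term of Ramanujan's theta function `f(x, y)`. -/
def thetaTerm (x y : R) (j : ℤ) : R := x ^ triangular j * y ^ triangular (j - 1)

/-- Consecutive theta terms have ratio x (xy)^j. The natural exponents e and a = e + j keep negative
powers of xy out of the statement. -/
theorem thetaTerm_add_one (x y : R) {e a : ℕ} {j : ℤ} (h : (e : ℤ) + j = a) :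
    (x * y) ^ e * thetaTerm x y (j + 1) = x * (x * y) ^ a * thetaTerm x y j := by
  have h1 := triangular_add_one j
  have h2 := triangular_eq_sub_one j
  simp only [thetaTerm, add_sub_cancel_right, mul_pow]
  have e1 : e + triangular (j + 1) = 1 + a + triangular j := by omega
  have e2 : e + triangular j = a + triangular (j - 1) := by omega
  calc _ = x ^ (e + triangular (j + 1)) * y ^ (e + triangular j) := by ring
    _ = _ := by rw [e1, e2]; ring

theorem thetaTerm_sub_one (x y : R) {e b : ℕ} {j : ℤ} (h : (e : ℤ) = b + j) :
    (x * y) ^ e * thetaTerm x y (j - 1) = y * (x * y) ^ b * thetaTerm x y j := by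
  have h1 := triangular_eq_sub_one (j - 1)
  have h2 := triangular_eq_sub_one j
  simp only [thetaTerm, mul_pow]
  have e1 : e + triangular (j - 1) = b + triangular j := by omega
  have e2 : e + triangular (j - 1 - 1) = 1 + b + triangular (j - 1) := by omega
  calc _ = x ^ (e + triangular (j - 1)) * y ^ (e + triangular (j - 1 - 1)) := by ring
    _ = _ := by rw [e1, e2]; ring

/-- The extra exponents of x and y are both T_j + T_{j-1} = j², the power of q that Bailey's lemma
supplies. As (x²y)(xy²) = (xy)³, this is where the modulus 3k comes from. -/
theorem thetaTerm_cubic (x y : R) (j : ℤ) :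
    thetaTerm (x ^ 2 * y) (x * y ^ 2) j = (x * y) ^ (j.natAbs ^ 2) * thetaTerm x y j := by
  rw [← triangular_add_triangular]
  simp only [thetaTerm]
  ring

/-- The finite form of Jacobi's triple product identity. -/
theorem IsInvPoch.finite_triple_product {x y : R} {c : ℕ → R} (hc : IsInvPoch (x * y) c)
    (a b : ℕ) :
    (∏ i ∈ Finset.range a, (1 + x * (x * y) ^ i)) * ∏ i ∈ Finset.range b, (1 + y * (x * y) ^ i) =
      ∑ m ∈ Finset.range (a + b + 1), gaussBinom (x * y) c (a + b) m * thetaTerm x y (m - b) := by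
  induction a with
  | zero =>
    induction b with
    | zero => simp [gaussBinom, qPoch, extendZero, hc.zero, thetaTerm, triangular]
    | succ b ih =>
      simp only [zero_add, Finset.range_zero, Finset.prod_empty, one_mul] at ih ⊢
      rw [Finset.prod_range_succ, ih]
      simp only [hc.gaussBinom_succ, add_mul, Finset.sum_add_distrib]
      rw [Finset.sum_range_succ' _ (b + 1), Finset.sum_range_succ _ (b + 1),
        gaussBinom_of_neg _ _ _ (j := ((0 : ℕ) : ℤ) - 1) (by simp),
        gaussBinom_of_lt _ _ b (j := ((b + 1 : ℕ) : ℤ)) (by simp)]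
      simp only [zero_mul, mul_zero, add_zero, mul_add, mul_one]
      congr 1
      · refine Finset.sum_congr rfl fun m _ ↦ ?_
        push_cast
        ring_nf
      · rw [Finset.sum_mul]
        refine Finset.sum_congr rfl fun m _ ↦ ?_
        have := thetaTerm_sub_one x y (e := m) (b := b) (j := m - b) (by ring)
        rw [Int.toNat_natCast, show (m : ℤ) - ((b + 1 : ℕ) : ℤ) = m - b - 1 by push_cast; ring]
        linear_combination -gaussBinom (x * y) c b m * this
  | succ a ih =>
    rw [Finset.prod_range_succ, mul_right_comm, ih, show a + 1 + b = a + b + 1 by ring]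
    simp only [hc.gaussBinom_succ', add_mul, Finset.sum_add_distrib]
    rw [Finset.sum_range_succ _ (a + b + 1), Finset.sum_range_succ' _ (a + b + 1),
      gaussBinom_of_neg _ _ _ (j := ((0 : ℕ) : ℤ) - 1) (by simp),
      gaussBinom_of_lt _ _ (a + b) (j := ((a + b + 1 : ℕ) : ℤ)) (by push_cast; omega)]
    simp only [zero_mul, mul_zero, add_zero, mul_add, mul_one]
    congr 1
    rw [Finset.sum_mul]
    refine Finset.sum_congr rfl fun m hm ↦ ?_
    have hm := Finset.mem_range.1 hm
    have := thetaTerm_add_one x y (e := a + b - m) (a := a) (j := m - b) (by omega)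
    rw [show (((a + b : ℕ) : ℤ) + 1 - ((m + 1 : ℕ) : ℤ)).toNat = a + b - m by omega,
      show ((m + 1 : ℕ) : ℤ) - 1 = m by push_cast; ring,
      show ((m + 1 : ℕ) : ℤ) - b = m - b + 1 by push_cast; ring]
    linear_combination -gaussBinom (x * y) c (a + b) m * this

/-- The finite triple product with equally many factors of both kinds, as a sum over a symmetric
interval. -/
theorem IsInvPoch.finite_triple_product_symm {x y : R} {c : ℕ → R} (hc : IsInvPoch (x * y) c)
    {m N : ℕ} (hm : m ≤ N) :
    (∏ i ∈ Finset.range m, (1 + x * (x * y) ^ i)) * ∏ i ∈ Finset.range m, (1 + y * (x * y) ^ i) =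
      qPoch (x * y) (2 * m) * ∑ j ∈ Finset.Icc (-N : ℤ) N,
        extendZero c (m + j) * extendZero c (m - j) * thetaTerm x y j := by
  rw [hc.finite_triple_product, Finset.mul_sum]
  rw [← Finset.sum_subset (s₁ := (Finset.range (m + m + 1)).image fun i : ℕ ↦ (i : ℤ) - m)]
  · rw [Finset.sum_image (fun a _ b _ h ↦ by simpa using h)]
    refine Finset.sum_congr rfl fun i _ ↦ ?_
    simp only [gaussBinom]
    rw [two_mul, show (m : ℤ) + (i - m) = i by ring,
      show (m : ℤ) - (i - m) = (m + m : ℕ) - i by push_cast; ring]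
    ring
  · intro j hj
    simp only [Finset.mem_image, Finset.mem_range] at hj
    obtain ⟨i, hi, rfl⟩ := hj
    rw [Finset.mem_Icc]
    omega
  -- Outside -m ≤ j ≤ m one of the two indices is negative, so the range can be enlarged to one
  -- independent of m; this later allows the two sums to be interchanged.
  · intro j _ hj
    have : (m : ℤ) + j < 0 ∨ (m : ℤ) - j < 0 := by
      by_contra! h
      refine hj (Finset.mem_image.2 ⟨(m + j).toNat, ?_, by omega⟩)
      rw [Finset.mem_range]
      omega
    rcases this with h | h <;> simp [extendZero_of_neg c h]

/-- A case of q-Chu–Vandermonde, by induction on M: after q-Pascal and a shift, the two terms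
carrying [M, s] combine through c_{s+a} = (1 - q^(s+a+1)) c_{s+a+1} into the summand for a + 1. -/
theorem IsInvPoch.sum_gaussBinom_mul {q : R} {c : ℕ → R} (hc : IsInvPoch q c) (M a : ℕ) :
    ∑ s ∈ Finset.range (M + 1), q ^ (s * (s + a)) * gaussBinom q c M s * c (s + a) =
      c (M + a) := by
  induction M generalizing a with
  | zero => simp [gaussBinom, qPoch, extendZero, hc.zero]
  | succ M ih =>
    rw [show M + 1 + a = M + (a + 1) by ring, ← ih]
    simp only [hc.gaussBinom_succ, add_mul, mul_add, Finset.sum_add_distrib]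
    rw [Finset.sum_range_succ', Finset.sum_range_succ _ (M + 1),
      gaussBinom_of_neg _ _ _ (j := ((0 : ℕ) : ℤ) - 1) (by simp),
      gaussBinom_of_lt _ _ M (j := ((M + 1 : ℕ) : ℤ)) (by simp)]
    simp only [zero_mul, mul_zero, add_zero]
    rw [← Finset.sum_add_distrib]
    refine Finset.sum_congr rfl fun s _ ↦ ?_
    rw [← hc.succ (s + a), Int.toNat_natCast, show ((s + 1 : ℕ) : ℤ) - 1 = s by push_cast; ring,
      show s + 1 + a = s + a + 1 by ring, show s + (a + 1) = s + a + 1 by ring]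
    ring

/-- The instance of the `q`-Chu–Vandermonde sum behind Bailey's lemma. -/
theorem IsInvPoch.sum_bailey_nat {q : R} {c : ℕ → R} (hc : IsInvPoch q c) {N t : ℕ} (ht : t ≤ N) :
    ∑ m ∈ Finset.range (N + 1), q ^ (m ^ 2) * c (N - m) *
        (extendZero c (m + t) * extendZero c (m - t)) =
      q ^ (t ^ 2) * (extendZero c (N + t) * extendZero c (N - t)) := by
  obtain ⟨M, rfl⟩ := Nat.exists_eq_add_of_le ht
  rw [add_assoc, Finset.sum_range_add, Finset.sum_eq_zero, zero_add]
  -- With m = t + s, m² = t² + s(s + 2t), hence the choice a = 2t.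
  · have h := hc.sum_gaussBinom_mul M (2 * t)
    rw [show ((t + M : ℕ) : ℤ) + t = (M + 2 * t : ℕ) by push_cast; ring,
      show ((t + M : ℕ) : ℤ) - t = M by push_cast; ring, extendZero_natCast, extendZero_natCast,
      ← h, Finset.sum_mul, Finset.mul_sum]
    refine Finset.sum_congr rfl fun s hs ↦ ?_
    have hs := Finset.mem_range.1 hs
    rw [show ((t + s : ℕ) : ℤ) + t = (s + 2 * t : ℕ) by push_cast; ring,
      show ((t + s : ℕ) : ℤ) - t = s by push_cast; ring, gaussBinom,
      show (M : ℤ) - s = (M - s : ℕ) by omega, extendZero_natCast, extendZero_natCast,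
      extendZero_natCast, show t + M - (t + s) = M - s by omega]
    have := hc.qPoch_mul M
    linear_combination (-q ^ ((t + s) ^ 2) * c (M - s) * c (s + 2 * t) * c s) * this
  · intro m hm
    have hm := Finset.mem_range.1 hm
    simp [extendZero_of_neg c (j := (m : ℤ) - t) (by omega)]

theorem IsInvPoch.sum_bailey {q : R} {c : ℕ → R} (hc : IsInvPoch q c) {N : ℕ} {j : ℤ}
    (hj : j.natAbs ≤ N) :
    ∑ m ∈ Finset.range (N + 1), q ^ (m ^ 2) * c (N - m) *
        (extendZero c (m + j) * extendZero c (m - j)) =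
      q ^ (j.natAbs ^ 2) * (extendZero c (N + j) * extendZero c (N - j)) := by
  have h := hc.sum_bailey_nat hj
  rcases Int.natAbs_eq j with h' | h'
  · rwa [← h'] at h
  · rw [show ((j.natAbs : ℕ) : ℤ) = -j by omega] at h
    simpa only [sub_neg_eq_add, ← sub_eq_add_neg, mul_comm (extendZero c (_ - j))] using h

/-- The finite form of the identity
`∑ q ^ m² (-x; q)_m (-y; q)_m / (q; q)_{2m} = f(x² y, x y²) / (q; q)_∞`, where `q = x y`. -/
theorem IsInvPoch.sum_triple_product {x y : R} {c : ℕ → R} (hc : IsInvPoch (x * y) c) (N : ℕ) :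
    ∑ m ∈ Finset.range (N + 1), c (N - m) * ((x * y) ^ (m ^ 2) * c (2 * m) *
        ((∏ i ∈ Finset.range m, (1 + x * (x * y) ^ i)) *
          ∏ i ∈ Finset.range m, (1 + y * (x * y) ^ i))) =
      ∑ j ∈ Finset.Icc (-N : ℤ) N,
        extendZero c (N + j) * extendZero c (N - j) * thetaTerm (x ^ 2 * y) (x * y ^ 2) j := by
  calc _ = ∑ m ∈ Finset.range (N + 1), ∑ j ∈ Finset.Icc (-N : ℤ) N, (x * y) ^ (m ^ 2) * c (N - m) *
        (extendZero c (m + j) * extendZero c (m - j)) * thetaTerm x y j := by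
        refine Finset.sum_congr rfl fun m hm ↦ ?_
        rw [hc.finite_triple_product_symm (Nat.lt_succ_iff.1 (Finset.mem_range.1 hm))]
        simp only [mul_assoc, ← Finset.mul_sum]
        linear_combination ((x * y) ^ (m ^ 2) * c (N - m) * ∑ j ∈ Finset.Icc (-N : ℤ) N,
          extendZero c (m + j) * (extendZero c (m - j) * thetaTerm x y j)) * hc.qPoch_mul (2 * m)
    _ = _ := by
        rw [Finset.sum_comm]
        refine Finset.sum_congr rfl fun j hj ↦ ?_
        rw [← Finset.sum_mul, hc.sum_bailey (by rw [Finset.mem_Icc] at hj; omega),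
          thetaTerm_cubic]
        ring

end QSeries

/-! ### Passing to the limit modulo powers of X -/

section Congruence

open PowerSeries

/-- The geometric series `1 / (1 - X ^ i)`. -/
noncomputable def geomSeries (i : ℕ) : ℤ⟦X⟧ := PowerSeries.mk fun d ↦ if i ∣ d then 1 else 0

theorem one_sub_X_pow_mul_geomSeries {i : ℕ} (hi : 0 < i) : (1 - X ^ i) * geomSeries i = 1 := by
  ext n
  rw [sub_mul, one_mul, map_sub, coeff_X_pow_mul', coeff_one]
  simp only [geomSeries, coeff_mk]
  rcases lt_or_ge n i with h | h
  · rw [if_neg h.not_ge, sub_zero]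
    refine if_congr ⟨fun h' ↦ Nat.eq_zero_of_dvd_of_lt h' h, fun h' ↦ h' ▸ dvd_zero i⟩ rfl rfl
  · rw [if_pos h, if_neg (show n ≠ 0 by omega)]
    have : i ∣ n - i ↔ i ∣ n := (Nat.dvd_sub_iff_left h dvd_rfl)
    simp [this]

/-- The inverse of `(q; q)_n` for `q = X ^ k`. -/
noncomputable def invPoch (k n : ℕ) : ℤ⟦X⟧ := ∏ i ∈ Finset.range n, geomSeries ((i + 1) * k)

theorem isInvPoch_invPoch {k : ℕ} (hk : 0 < k) : IsInvPoch (X ^ k) (invPoch k) where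
  zero := by simp [invPoch]
  succ n := by
    rw [invPoch, Finset.prod_range_succ, mul_left_comm, ← pow_mul, mul_comm k,
      one_sub_X_pow_mul_geomSeries (by positivity), mul_one, invPoch]

/-- Reduction of power series modulo `X ^ d`. -/
noncomputable abbrev reduce (d : ℕ) : ℤ⟦X⟧ →+* ℤ⟦X⟧ ⧸ Ideal.span {(X : ℤ⟦X⟧) ^ d} := Ideal.Quotient.mk _

theorem reduce_eq_iff {d : ℕ} {f g : ℤ⟦X⟧} : reduce d f = reduce d g ↔ X ^ d ∣ f - g := by
  rw [Ideal.Quotient.eq, Ideal.mem_span_singleton]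

/-- The additional factors are 1 - X^(k(i+1)) with k(i+1) ≥ a + 1 ≥ d, hence congruent to 1. -/
theorem reduce_qPoch {k : ℕ} (hk : 0 < k) {d a b : ℕ} (ha : d ≤ a + 1) (hab : a ≤ b) :
    reduce d (qPoch (X ^ k) b) = reduce d (qPoch (X ^ k) a) := by
  induction b, hab using Nat.le_induction with
  | base => rfl
  | succ b hb ih =>
    rw [← ih, reduce_eq_iff, qPoch_succ, mul_sub, mul_one, sub_sub_cancel_left, dvd_neg, ← pow_mul]
    refine Dvd.dvd.mul_left (pow_dvd_pow _ ?_) _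
    nlinarith

theorem IsInvPoch.reduce_eq {k : ℕ} (hk : 0 < k) {c : ℕ → ℤ⟦X⟧} (hc : IsInvPoch (X ^ k) c)
    {d a b : ℕ} (ha : d ≤ a + 1) (hab : a ≤ b) : reduce d (c b) = reduce d (c a) := by
  have h := reduce_qPoch hk ha hab
  have ha := congrArg (reduce d) (hc.qPoch_mul a)
  have hb := congrArg (reduce d) (hc.qPoch_mul b)
  rw [map_mul, map_one] at ha hb
  linear_combination (-(reduce d (c b))) * ha + reduce d (c a) * hb -
    (reduce d (c a)) * reduce d (c b) * h

theorem X_pow_dvd_mul_sub {N a d : ℕ} (h : N ≤ a + d) {u v w : ℤ⟦X⟧} (hu : X ^ a ∣ u)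
    (hvw : reduce d v = reduce d w) : X ^ N ∣ u * v - u * w := by
  rw [← mul_sub]
  exact (pow_dvd_pow _ h).trans (pow_add (X : ℤ⟦X⟧) a d ▸ mul_dvd_mul hu (reduce_eq_iff.1 hvw))

/-- The finite product `(-x; q)_m (-y; q)_m` with `x = X ^ r`, `y = X ^ (k - r)`, `q = X ^ k`. -/
noncomputable def distinctProd (k r m : ℕ) : ℤ⟦X⟧ :=
  (∏ i ∈ Finset.range m, (1 + X ^ (i * k + r))) *
    ∏ i ∈ Finset.range m, (1 + X ^ ((i + 1) * k - r))

theorem distinctProd_eq {k r : ℕ} (hr : r ≤ k) (m : ℕ) :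
    distinctProd k r m = (∏ i ∈ Finset.range m, (1 + X ^ r * (X ^ r * X ^ (k - r)) ^ i)) *
      ∏ i ∈ Finset.range m, (1 + X ^ (k - r) * (X ^ r * X ^ (k - r)) ^ i) := by
  obtain ⟨s, rfl⟩ := Nat.exists_eq_add_of_le hr
  simp only [distinctProd, Nat.add_sub_cancel_left, ← pow_add, ← pow_mul]
  congr 1
  · refine Finset.prod_congr rfl fun i _ ↦ ?_
    ring_nf
  · refine Finset.prod_congr rfl fun i _ ↦ ?_
    rw [show (i + 1) * (r + s) - r = s + (r + s) * i from Nat.sub_eq_of_eq_add (by ring)]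

/-- Both sides are compared with (q; q)_N times the finite Bailey sum. A term already divisible by
X^a needs its cofactor only modulo X^(N+1-a), and to that precision the Pochhammer symbols have
stabilised. -/
theorem X_pow_dvd_sum_sub_prod {k r : ℕ} (hk : 0 < k) (hr : r ≤ k) (N : ℕ) :
    X ^ (N + 1) ∣
      (∑ m ∈ Finset.range (N + 1),
        X ^ (k * m ^ 2) * invPoch k (2 * m) * distinctProd k r m) -
      invPoch k (3 * N) * qPoch (X ^ (3 * k)) N * distinctProd (3 * k) (k + r) N := by
  have hk3 : 0 < 3 * k := by positivity
  have hxy : (X : ℤ⟦X⟧) ^ r * X ^ (k - r) = X ^ k := by rw [← pow_add]; congr 1; omega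
  have hc := isInvPoch_invPoch hk
  have hc3 := isInvPoch_invPoch hk3
  set c := invPoch k
  set c3 := invPoch (3 * k)
  set A : ℕ → ℤ⟦X⟧ := fun m ↦ X ^ (k * m ^ 2) * c (2 * m) * distinctProd k r m with hA
  set θ : ℤ → ℤ⟦X⟧ :=
    thetaTerm ((X ^ r) ^ 2 * X ^ (k - r)) (X ^ r * (X ^ (k - r)) ^ 2) with hθ
  have hsum : ∑ m ∈ Finset.range (N + 1), c (N - m) * A m =
      ∑ j ∈ Finset.Icc (-N : ℤ) N, extendZero c (N + j) * extendZero c (N - j) * θ j := by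
    have := IsInvPoch.sum_triple_product (x := X ^ r) (y := X ^ (k - r)) (c := c)
      (by rwa [hxy]) N
    rw [← this]
    refine Finset.sum_congr rfl fun m _ ↦ ?_
    simp only [hA, distinctProd_eq hr, hxy, pow_mul]
  have hprod : distinctProd (3 * k) (k + r) N = qPoch (X ^ (3 * k)) (2 * N) *
      ∑ j ∈ Finset.Icc (-N : ℤ) N, extendZero c3 (N + j) * extendZero c3 (N - j) * θ j := by
    have hx : (X : ℤ⟦X⟧) ^ (k + r) = (X ^ r) ^ 2 * X ^ (k - r) := by
      rw [← pow_mul, ← pow_add]; congr 1; omega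
    have hy : (X : ℤ⟦X⟧) ^ (3 * k - (k + r)) = X ^ r * (X ^ (k - r)) ^ 2 := by
      rw [← pow_mul, ← pow_add]; congr 1; omega
    have hq : (X : ℤ⟦X⟧) ^ (k + r) * X ^ (3 * k - (k + r)) = X ^ (3 * k) := by
      rw [← pow_add]; congr 1; omega
    have := IsInvPoch.finite_triple_product_symm (x := X ^ (k + r))
      (y := X ^ (3 * k - (k + r))) (c := c3) (by rwa [hq]) (le_refl N)
    rw [distinctProd_eq (by omega), this, hq, hx, hy]
  have hdvd : ∀ j : ℤ, X ^ j.natAbs ∣ θ j := by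
    intro j
    rw [hθ, thetaTerm_cubic, hxy, ← pow_mul]
    refine Dvd.dvd.mul_right (pow_dvd_pow _ ?_) _
    nlinarith [Nat.le_self_pow two_ne_zero j.natAbs]
  have h1 : X ^ (N + 1) ∣ qPoch (X ^ k) N * ∑ m ∈ Finset.range (N + 1), c (N - m) * A m -
      ∑ m ∈ Finset.range (N + 1), A m := by
    rw [Finset.mul_sum, ← Finset.sum_sub_distrib]
    refine Finset.dvd_sum fun m hm ↦ ?_
    have hm : m ≤ N := Nat.lt_succ_iff.1 (Finset.mem_range.1 hm)
    have : reduce (N + 1 - m) (qPoch (X ^ k) N * c (N - m)) = reduce (N + 1 - m) 1 := by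
      rw [map_mul, reduce_qPoch hk (show N + 1 - m ≤ N - m + 1 by omega) (by omega), ← map_mul,
        hc.qPoch_mul]
    have hmA : X ^ m ∣ A m := by
      rw [hA]
      simp only [mul_assoc]
      refine Dvd.dvd.mul_right (pow_dvd_pow _ ?_) _
      nlinarith [Nat.le_self_pow two_ne_zero m]
    have := X_pow_dvd_mul_sub (N := N + 1) (by omega) hmA this
    convert this using 1
    ring
  have h2 : X ^ (N + 1) ∣ qPoch (X ^ k) N * ∑ m ∈ Finset.range (N + 1), c (N - m) * A m -
      c (3 * N) * qPoch (X ^ (3 * k)) N * distinctProd (3 * k) (k + r) N := by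
    rw [hsum, hprod, Finset.mul_sum, Finset.mul_sum, Finset.mul_sum, ← Finset.sum_sub_distrib]
    refine Finset.dvd_sum fun j hj ↦ ?_
    obtain ⟨hj1, hj2⟩ := Finset.mem_Icc.1 hj
    obtain ⟨a, ha⟩ : ∃ a : ℕ, (N : ℤ) + j = a := ⟨(N + j).toNat, by omega⟩
    obtain ⟨b, hb⟩ : ∃ b : ℕ, (N : ℤ) - j = b := ⟨(N - j).toNat, by omega⟩
    simp only [ha, hb, extendZero_natCast]
    -- All indices involved are at least t, so modulo X^(t+1) each may be replaced by t; both
    -- cofactors then reduce to c t.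
    set t := N - j.natAbs with ht
    have hat : t ≤ a := by omega
    have hbt : t ≤ b := by omega
    have : reduce (t + 1) (qPoch (X ^ k) N * (c a * c b)) = reduce (t + 1)
        (c (3 * N) * qPoch (X ^ (3 * k)) N * (qPoch (X ^ (3 * k)) (2 * N) * (c3 a * c3 b))) := by
      have e1 := congrArg (reduce (t + 1)) (hc.qPoch_mul t)
      have e2 := congrArg (reduce (t + 1)) (hc3.qPoch_mul t)
      simp only [map_mul, map_one] at e1 e2 ⊢
      rw [reduce_qPoch hk le_rfl (show t ≤ N by omega), hc.reduce_eq hk le_rfl hat,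
        hc.reduce_eq hk le_rfl hbt, reduce_qPoch hk3 le_rfl (show t ≤ N by omega),
        hc.reduce_eq hk le_rfl (show t ≤ 3 * N by omega), hc3.reduce_eq hk3 le_rfl hat,
        hc3.reduce_eq hk3 le_rfl hbt, reduce_qPoch hk3 le_rfl (show t ≤ 2 * N by omega)]
      linear_combination reduce (t + 1) (c t) * e1 - reduce (t + 1) (c t) *
        (reduce (t + 1) (qPoch (X ^ (3 * k)) t) * reduce (t + 1) (c3 t) + 1) * e2
    have := X_pow_dvd_mul_sub (N := N + 1) (by omega) (hdvd j) this
    convert this using 1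
    ring
  convert dvd_sub h2 h1 using 1
  ring

end Congruence

/-! ### Partitions as coefficients of products -/

section Counting

open PowerSeries

/-- A partition with parts in S corresponds to the function sending i to the total i · (multiplicity
of i), and coefficients of a product are sums over such functions. The predicate P i restricts the
multiplicity of i. -/
theorem card_partition_eq_coeff {S : Finset ℕ} (hS : 0 ∉ S) (P : ℕ → ℕ → Prop)
    [∀ i, DecidablePred (P i)] (n : ℕ) :
    ((Finset.univ.filter fun p : n.Partition ↦
        (∀ i ∈ p.parts, i ∈ S) ∧ ∀ i ∈ S, P i (p.parts.count i)).card : ℤ) =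
      coeff n (∏ i ∈ S, (PowerSeries.mk fun d ↦ if i ∣ d ∧ P i (d / i) then 1 else 0 : ℤ⟦X⟧)) := by
  rw [coeff_prod]
  simp only [coeff_mk, Finset.prod_ite_zero, Finset.prod_const_one, Finset.sum_boole]
  norm_cast
  have hpos : ∀ i ∈ S, 0 < i := fun i hi ↦ Nat.pos_of_ne_zero fun h ↦ hS (h ▸ hi)
  refine Finset.card_nbij Nat.Partition.toFinsuppAntidiag ?_
    (Nat.Partition.toFinsuppAntidiag_injective n).injOn ?_
  · intro p hp
    simp only [Finset.coe_filter, Finset.mem_univ, true_and, Set.mem_ofPred_eq] at hp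
    simp only [Finset.coe_filter, Finset.mem_finsuppAntidiag, Set.mem_ofPred_eq]
    have hsub : p.parts.toFinset ⊆ S := fun i hi ↦ hp.1 i (Multiset.mem_toFinset.1 hi)
    refine ⟨⟨?_, hsub⟩, fun i hi ↦ ⟨Dvd.intro_left _ rfl, ?_⟩⟩
    · have := Finset.sum_multiset_count_of_subset p.parts S hsub
      rw [p.parts_sum] at this
      simpa [Nat.Partition.toFinsuppAntidiag] using this.symm
    · simpa [Nat.Partition.toFinsuppAntidiag, hpos i hi] using hp.2 i hi
  · intro l hl
    simp only [Finset.coe_filter, Finset.mem_finsuppAntidiag, Set.mem_ofPred_eq] at hl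
    obtain ⟨⟨hsum, hsupp⟩, hl⟩ := hl
    set s : Multiset ℕ := ∑ i ∈ S, Multiset.replicate (l i / i) i with hs
    have hcount : ∀ i, s.count i = if i ∈ S then l i / i else 0 := by
      intro i
      rw [hs, Multiset.count_sum']
      simp [Multiset.count_replicate]
    have hmem : ∀ i ∈ s, i ∈ S := by
      intro i hi
      by_contra h
      have := hcount i
      rw [if_neg h] at this
      exact Multiset.count_eq_zero.1 this hi
    have hssum : s.sum = n := by
      rw [hs, Multiset.sum_sum, ← hsum]
      refine Finset.sum_congr rfl fun i hi ↦ ?_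
      rw [Multiset.sum_replicate, smul_eq_mul, Nat.div_mul_cancel (hl i hi).1]
    refine ⟨⟨s, fun hi ↦ hpos _ (hmem _ hi), hssum⟩, ?_, ?_⟩
    · simp only [Finset.coe_filter, Finset.mem_univ, true_and, Set.mem_ofPred_eq]
      refine ⟨hmem, fun i hi ↦ ?_⟩
      rw [hcount, if_pos hi]
      exact (hl i hi).2
    · ext i
      change s.count i * i = l i
      rw [hcount]
      split_ifs with hi
      · exact Nat.div_mul_cancel (hl i hi).1
      · rw [zero_mul]
        by_contra h
        exact hi (hsupp (Finsupp.mem_support_iff.2 (Ne.symm h)))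

theorem mk_dvd_and_one_le {i : ℕ} (hi : 0 < i) :
    (PowerSeries.mk fun d ↦ if i ∣ d ∧ 1 ≤ d / i then 1 else 0 : ℤ⟦X⟧) = X ^ i * geomSeries i := by
  ext n
  rw [coeff_X_pow_mul']
  simp only [geomSeries, coeff_mk, Nat.one_le_div_iff hi]
  split_ifs with h1 h2 h3 h2 h3 <;> first | rfl | skip
  · exact absurd (Nat.dvd_sub h1.1 dvd_rfl) h3
  · exact absurd h1.2 h2
  · exact absurd ⟨(Nat.dvd_sub_iff_left h2 dvd_rfl).1 h3, h2⟩ h1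

theorem mk_dvd_and_le_one {i : ℕ} (hi : 0 < i) :
    (PowerSeries.mk fun d ↦ if i ∣ d ∧ d / i ≤ 1 then 1 else 0 : ℤ⟦X⟧) = 1 + X ^ i := by
  ext n
  rw [map_add, coeff_X_pow, coeff_one, coeff_mk]
  have h : i ∣ n ∧ n / i ≤ 1 ↔ n = 0 ∨ n = i := by
    constructor
    · rintro ⟨⟨t, rfl⟩, h⟩
      rw [Nat.mul_div_cancel_left _ hi] at h
      interval_cases t <;> simp
    · rintro (rfl | rfl) <;> simp [hi]
  simp only [h]
  rcases eq_or_ne n 0 with rfl | h0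
  · simp [hi.ne]
  · simp [h0]

/-! ### The residue classes ±r modulo k -/

/-- The smallest positive integers congruent to `± r` modulo `k`, `m` in each class. -/
def distinctParts (k r m : ℕ) : Finset ℕ :=
  (Finset.range m).image (fun i ↦ i * k + r) ∪ (Finset.range m).image fun i ↦ (i + 1) * k - r

/-- Otherwise 2r would be a multiple of k strictly between 0 and 2k, hence k itself. -/
theorem mul_add_ne_mul_sub {k r : ℕ} (hr : 0 < r) (hrk : r < k) (h2 : 2 * r ≠ k) (i j : ℕ) :
    i * k + r ≠ (j + 1) * k - r := by
  intro h
  have hj : i * k + 2 * r = (j + 1) * k := by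
    have : k ≤ (j + 1) * k := Nat.le_mul_of_pos_left k (by omega)
    omega
  rcases lt_trichotomy i j with hij | rfl | hij
  · obtain ⟨t, rfl⟩ := Nat.exists_eq_add_of_lt hij
    nlinarith [Nat.zero_le (t * k)]
  · apply h2
    linarith
  · obtain ⟨t, rfl⟩ := Nat.exists_eq_add_of_lt hij
    nlinarith [Nat.zero_le (t * k)]

theorem mul_sub_injective {k r : ℕ} (hrk : r < k) :
    Function.Injective fun i : ℕ ↦ (i + 1) * k - r := by
  intro i j h
  have hi : k ≤ (i + 1) * k := Nat.le_mul_of_pos_left k (by omega)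
  have hj : k ≤ (j + 1) * k := Nat.le_mul_of_pos_left k (by omega)
  have : (i + 1) * k = (j + 1) * k := by simp only at h; omega
  simpa using Nat.eq_of_mul_eq_mul_right (by omega) this

theorem mul_add_injective {k : ℕ} (hk : 0 < k) (r : ℕ) :
    Function.Injective fun i : ℕ ↦ i * k + r := by
  intro i j h
  exact Nat.eq_of_mul_eq_mul_right hk (by simpa using h)

theorem prod_distinctParts {k r : ℕ} (hr : 0 < r) (hrk : r < k) (h2 : 2 * r ≠ k) (m : ℕ)
    (f : ℕ → ℤ⟦X⟧) :
    ∏ i ∈ distinctParts k r m, f i =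
      (∏ i ∈ Finset.range m, f (i * k + r)) * ∏ i ∈ Finset.range m, f ((i + 1) * k - r) := by
  rw [distinctParts, Finset.prod_union, Finset.prod_image (mul_add_injective (by omega) r).injOn,
    Finset.prod_image (mul_sub_injective hrk).injOn]
  rw [Finset.disjoint_left]
  intro a ha hb
  obtain ⟨i, -, rfl⟩ := Finset.mem_image.1 ha
  obtain ⟨j, -, h⟩ := Finset.mem_image.1 hb
  exact mul_add_ne_mul_sub hr hrk h2 i j h.symm

theorem mem_distinctParts {k r m a : ℕ} (hrk : r < k) : a ∈ distinctParts k r m ↔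
    (∃ i < m, a = i * k + r) ∨ ∃ i < m, a + r = (i + 1) * k := by
  simp only [distinctParts, Finset.mem_union, Finset.mem_image, Finset.mem_range]
  refine or_congr ⟨fun ⟨i, h, e⟩ ↦ ⟨i, h, e.symm⟩, fun ⟨i, h, e⟩ ↦ ⟨i, h, e.symm⟩⟩
    ⟨fun ⟨i, h, e⟩ ↦ ⟨i, h, ?_⟩, fun ⟨i, h, e⟩ ↦ ⟨i, h, by omega⟩⟩
  have : k ≤ (i + 1) * k := Nat.le_mul_of_pos_left k (by omega)
  omega

theorem pos_of_mem_distinctParts {k r m a : ℕ} (hr : 0 < r) (hrk : r < k)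
    (ha : a ∈ distinctParts k r m) : 0 < a := by
  rcases (mem_distinctParts hrk).1 ha with ⟨i, -, h⟩ | ⟨i, -, h⟩
  · omega
  · have : k ≤ (i + 1) * k := Nat.le_mul_of_pos_left k (by omega)
    omega

theorem prod_distinctParts_mk {k r : ℕ} (hr : 0 < r) (hrk : r < k) (h2 : 2 * r ≠ k) (m : ℕ)
    (P : ℕ → ℕ → Prop) [∀ i, DecidablePred (P i)]
    (hP : ∀ i ∈ distinctParts k r m, ∀ d, P i d ↔ d ≤ 1) :
    ∏ i ∈ distinctParts k r m, (PowerSeries.mk fun d ↦ if i ∣ d ∧ P i (d / i) then 1 else 0) =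
      distinctProd k r m := by
  rw [distinctProd, ← prod_distinctParts hr hrk h2 m fun i ↦ 1 + X ^ i]
  refine Finset.prod_congr rfl fun i hi ↦ ?_
  simp only [hP i hi, mk_dvd_and_le_one (pos_of_mem_distinctParts hr hrk hi)]

theorem natCast_modEq_iff {k r i : ℕ} (hrk : r < k) :
    (i : ℤ) ≡ r [ZMOD k] ↔ ∃ j : ℕ, i = j * k + r := by
  rw [Int.natCast_modEq_iff]
  constructor
  · intro h
    refine ⟨i / k, ?_⟩
    have h' : i % k = r := Eq.trans h (Nat.mod_eq_of_lt hrk)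
    rw [← h', mul_comm]
    exact (Nat.div_add_mod i k).symm
  · rintro ⟨j, rfl⟩
    simp [Nat.ModEq]

theorem natCast_modEq_neg_iff {k r i : ℕ} (hr : 0 < r) :
    (i : ℤ) ≡ -r [ZMOD k] ↔ ∃ j : ℕ, i + r = (j + 1) * k := by
  rw [Int.modEq_comm, Int.modEq_iff_dvd, sub_neg_eq_add]
  norm_cast
  constructor
  · rintro ⟨t, ht⟩
    obtain _ | t := t
    · omega
    · exact ⟨t, by rw [ht, mul_comm]⟩
  · rintro ⟨j, hj⟩
    exact ⟨j + 1, by rw [hj, mul_comm]⟩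

theorem congrPM_iff {k r i : ℕ} (hr : 0 < r) (hrk : r < k) : CongrPM k r i ↔
    (∃ j : ℕ, i = j * k + r) ∨ ∃ j : ℕ, i + r = (j + 1) * k := by
  rw [CongrPM, natCast_modEq_iff hrk, natCast_modEq_neg_iff hr]

theorem CongrPM.not_dvd {k r i : ℕ} (hr : 0 < r) (hrk : r < k) (h : CongrPM k r i) : ¬ k ∣ i := by
  intro hi
  have hk : k ∣ r := by
    rcases (congrPM_iff hr hrk).1 h with ⟨j, rfl⟩ | ⟨j, hj⟩
    · exact (Nat.dvd_add_right (Dvd.intro_left _ rfl)).1 hi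
    · exact (Nat.dvd_add_right hi).1 (hj ▸ Dvd.intro_left _ rfl)
  exact absurd (Nat.le_of_dvd hr hk) (by omega)

theorem congrPM_of_mem_distinctParts {k r m i : ℕ} (hr : 0 < r) (hrk : r < k)
    (h : i ∈ distinctParts k r m) : CongrPM k r i := by
  rw [congrPM_iff hr hrk]
  rcases (mem_distinctParts hrk).1 h with ⟨j, -, h⟩ | ⟨j, -, h⟩
  exacts [.inl ⟨j, h⟩, .inr ⟨j, h⟩]

theorem mem_distinctParts_of_congrPM {k r m i : ℕ} (hr : 0 < r) (hrk : r < k) (him : i ≤ m)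
    (h : CongrPM k r i) : i ∈ distinctParts k r m := by
  rw [mem_distinctParts hrk]
  refine ((congrPM_iff hr hrk).1 h).imp (fun ⟨j, hj⟩ ↦ ⟨j, ?_, hj⟩) fun ⟨j, hj⟩ ↦ ⟨j, ?_, hj⟩
  · have := Nat.le_mul_of_pos_right j (show 0 < k by omega)
    omega
  · have := Nat.le_mul_of_pos_right j (show 0 < k by omega)
    rw [add_mul, one_mul] at hj
    omega

end Counting

section MainTheorem

open PowerSeries

/-! ### The partitions counted by `B` -/

/-- The classes ±k modulo 3k are the multiples of k that are not multiples of 3k, whence (q³; q³)_N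
/ (q; q)_{3N}. Parts are at most n ≤ N, so N members of each class suffice. -/
theorem countB_eq_coeff {k r : ℕ} (hr : 0 < r) (hrk : 2 * r < k) {n N : ℕ} (hn : n ≤ N) :
    (countB k r n : ℤ) = coeff n
      (invPoch k (3 * N) * qPoch (X ^ (3 * k)) N * distinctProd (3 * k) (k + r) N) := by
  have hk : 0 < k := by omega
  have hlt : k + r < 3 * k := by omega
  have hnd : ∀ i, CongrPM (3 * k) (k + r) i → ¬ k ∣ i := by
    intro i hi hd
    have hkr : k ∣ k + r := by
      rcases (congrPM_iff (by omega) hlt).1 hi with ⟨j, rfl⟩ | ⟨j, hj⟩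
      · exact (Nat.dvd_add_right (Dvd.intro_left (j * 3) (by ring))).1 hd
      · exact (Nat.dvd_add_right hd).1 (hj ▸ Dvd.intro_left ((j + 1) * 3) (by ring))
    exact absurd (Nat.le_of_dvd hr ((Nat.dvd_add_right dvd_rfl).1 hkr)) (by omega)
  have hdvd : ∀ i, CongrPM (3 * k) k i → k ∣ i := by
    intro i hi
    rcases (congrPM_iff hk (by omega)).1 hi with ⟨j, rfl⟩ | ⟨j, hj⟩
    · exact Dvd.intro_left (j * 3 + 1) (by ring)
    · exact (Nat.dvd_add_left dvd_rfl).1 (hj ▸ Dvd.intro_left ((j + 1) * 3) (by ring))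
  set M := distinctParts (3 * k) k N
  set D := distinctParts (3 * k) (k + r) N
  have hM : ∀ i ∈ M, k ∣ i := fun i hi ↦
    hdvd i (congrPM_of_mem_distinctParts hk (by omega) hi)
  have hD : ∀ i ∈ D, ¬ k ∣ i := fun i hi ↦
    hnd i (congrPM_of_mem_distinctParts (by omega) hlt hi)
  have hdisj : Disjoint M D := Finset.disjoint_left.2 fun i h1 h2 ↦ hD i h2 (hM i h1)
  have hS : 0 ∉ M ∪ D := by
    intro h
    rcases Finset.mem_union.1 h with h | h
    · exact (pos_of_mem_distinctParts hk (by omega) h).ne rfl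
    · exact (pos_of_mem_distinctParts (by omega) hlt h).ne rfl
  have hcard := card_partition_eq_coeff hS (fun i c ↦ k ∣ i ∨ c ≤ 1) n
  rw [Finset.prod_union hdisj, prod_distinctParts_mk (by omega) hlt (by omega) N (fun i c ↦ k ∣ i ∨ c ≤ 1)
    (fun i hi d ↦ by simp [hD i hi])] at hcard
  have hprod : ∏ i ∈ M, (PowerSeries.mk fun d ↦
        if i ∣ d ∧ (k ∣ i ∨ d / i ≤ 1) then 1 else 0 : ℤ⟦X⟧) =
      invPoch k (3 * N) * qPoch (X ^ (3 * k)) N := by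
    have : ∀ i ∈ M, (PowerSeries.mk fun d ↦
        if i ∣ d ∧ (k ∣ i ∨ d / i ≤ 1) then 1 else 0 : ℤ⟦X⟧) = geomSeries i := by
      intro i hi
      simp [hM i hi, geomSeries]
    rw [Finset.prod_congr rfl this, prod_distinctParts hk (by omega) (by omega)]
    clear * - hk
    induction N with
    | zero => simp [invPoch, qPoch]
    | succ N ih =>
      -- Of the three new geometric series, the one for a multiple of 3k cancels against the new
      -- factor of (q³; q³).
      have h := one_sub_X_pow_mul_geomSeries (i := (3 * N + 2 + 1) * k) (by positivity)
      rw [Finset.prod_range_succ, Finset.prod_range_succ, mul_mul_mul_comm, ih, qPoch_succ,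
        show 3 * (N + 1) = 3 * N + 1 + 1 + 1 by ring]
      simp only [invPoch, Finset.prod_range_succ]
      rw [show (N + 1) * (3 * k) - k = (3 * N + 1 + 1) * k from Nat.sub_eq_of_eq_add (by ring),
        show N * (3 * k) + k = (3 * N + 1) * k by ring, ← pow_mul,
        show 3 * k * (N + 1) = (3 * N + 2 + 1) * k by ring,
        show (3 * N + 1 + 1 + 1) = 3 * N + 2 + 1 by ring]
      linear_combination (-(∏ i ∈ Finset.range (3 * N), geomSeries ((i + 1) * k)) *
        qPoch (X ^ (3 * k)) N * (geomSeries ((3 * N + 1) * k) *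
          geomSeries ((3 * N + 1 + 1) * k))) * h
  rw [hprod] at hcard
  rw [← hcard, countB]
  norm_cast
  congr 1
  refine Finset.filter_congr fun p _ ↦ ?_
  have hle : ∀ i ∈ p.parts, i ≤ N := fun i hi ↦ by
    have := Multiset.single_le_sum (fun _ _ ↦ Nat.zero_le _) i hi
    rw [p.parts_sum] at this
    omega
  constructor
  · rintro ⟨h1, h2⟩
    refine ⟨fun i hi ↦ ?_, fun i hi ↦ ?_⟩
    · rw [Finset.mem_union]
      exact (h1 i hi).symm.imp
        (mem_distinctParts_of_congrPM hk (by omega) (hle i hi))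
        (mem_distinctParts_of_congrPM (by omega) hlt (hle i hi))
    · by_cases hp : i ∈ p.parts
      · exact (h1 i hp).symm.imp (hdvd i) fun h ↦ (h2 i hp h).le
      · exact .inr (by simp [Multiset.count_eq_zero.2 hp])
  · rintro ⟨h1, h2⟩
    refine ⟨fun i hi ↦ ?_, fun i hi hc ↦ ?_⟩
    · exact (Finset.mem_union.1 (h1 i hi)).symm.imp
        (congrPM_of_mem_distinctParts (by omega) hlt)
        (congrPM_of_mem_distinctParts hk (by omega))
    · exact le_antisymm ((h2 i (h1 i hi)).resolve_left (hnd i hc))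
        (Multiset.one_le_count_iff_mem.2 hi)

/-! ### The partitions counted by `A` -/

theorem isOddMultiple_iff {k i : ℕ} (hk : 0 < k) :
    IsOddMultiple k i ↔ ∃ t, i = (2 * t + 1) * k := by
  constructor
  · rintro ⟨⟨s, rfl⟩, h⟩
    rw [Nat.mul_div_cancel_left _ hk] at h
    obtain ⟨t, rfl⟩ := h
    exact ⟨t, mul_comm _ _⟩
  · rintro ⟨t, rfl⟩
    refine ⟨Dvd.intro_left _ rfl, ?_⟩
    rw [Nat.mul_div_cancel _ hk]
    exact odd_two_mul_add_one t

theorem isEvenMultiple_iff {k i : ℕ} (hk : 0 < k) : IsEvenMultiple k i ↔ ∃ t, i = 2 * t * k := by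
  constructor
  · rintro ⟨⟨s, rfl⟩, h⟩
    rw [Nat.mul_div_cancel_left _ hk] at h
    obtain ⟨t, rfl⟩ := h
    exact ⟨t, by ring⟩
  · rintro ⟨t, rfl⟩
    refine ⟨Dvd.intro_left _ rfl, ?_⟩
    rw [Nat.mul_div_cancel _ hk]
    exact even_two_mul t

theorem le_largestOddMultiple {k n i : ℕ} {p : n.Partition} (hi : i ∈ p.parts)
    (h : IsOddMultiple k i) : i ≤ largestOddMultiple k p :=
  Multiset.le_sup (Multiset.mem_filter.2 ⟨hi, h⟩)

theorem largestOddMultiple_eq_zero_or_mem (k : ℕ) {n : ℕ} (p : n.Partition) :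
    largestOddMultiple k p = 0 ∨
      largestOddMultiple k p ∈ p.parts ∧ IsOddMultiple k (largestOddMultiple k p) := by
  have : ∀ s : Multiset ℕ, s.sup = 0 ∨ s.sup ∈ s := by
    intro s
    induction s using Multiset.induction with
    | empty => exact .inl rfl
    | cons a s ih =>
      rw [Multiset.sup_cons]
      rcases le_total a s.sup with h | h
      · rw [sup_eq_right.2 h]
        exact ih.imp_right (Multiset.mem_cons_of_mem)
      · rw [sup_eq_left.2 h]
        exact .inr (Multiset.mem_cons_self a s)
  exact (this _).imp_right Multiset.mem_filter.1

theorem largestOddMultiple_eq {k n L : ℕ} {p : n.Partition}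
    (h : ∀ i ∈ p.parts, IsOddMultiple k i → i ≤ L)
    (hL : L = 0 ∨ L ∈ p.parts ∧ IsOddMultiple k L) : largestOddMultiple k p = L := by
  refine le_antisymm (Multiset.sup_le.2 fun i hi ↦ ?_) ?_
  · obtain ⟨h1, h2⟩ := Multiset.mem_filter.1 hi
    exact h i h1 h2
  · rcases hL with rfl | ⟨h1, h2⟩
    · exact Nat.zero_le _
    · exact le_largestOddMultiple h1 h2

/-- The first `n` positive multiples of `k`. -/
def multiples (k n : ℕ) : Finset ℕ := (Finset.range n).image fun i ↦ (i + 1) * k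

theorem mem_multiples {k n a : ℕ} : a ∈ multiples k n ↔ ∃ t < n, a = (t + 1) * k := by
  simp [multiples, eq_comm]

theorem ratCast_lt_half_iff {i L : ℕ} : (i : ℚ) < (L : ℚ) / 2 ↔ 2 * i < L := by
  rw [lt_div_iff₀ two_pos, mul_comm]
  norm_cast

/-- Once L = (2m-1)k is fixed, the bounds become membership in a finite set and conditions on single
multiplicities: as 0 < 2r < k, jk + r < L/2 and (j+1)k - r < (k+L)/2 both mean j < m. Truncated
subtraction gives L = 0 at m = 0. -/
theorem isTypeA_and_iff {k r : ℕ} (hr : 0 < r) (hrk : 2 * r < k) {n : ℕ} (m : ℕ)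
    (p : n.Partition) :
    (IsTypeA k r p ∧ largestOddMultiple k p = (2 * m - 1) * k) ↔
      (∀ i ∈ p.parts, i ∈ multiples k (2 * m) ∪ distinctParts k r m) ∧
        ∀ i ∈ multiples k (2 * m) ∪ distinctParts k r m,
          if k ∣ i then IsOddMultiple k i → 1 ≤ p.parts.count i else p.parts.count i ≤ 1 := by
  have hk : 0 < k := by omega
  have hrk' : r < k := by omega
  unfold IsTypeA
  simp only [← add_div, ← Nat.cast_add, ratCast_lt_half_iff, natCast_modEq_iff hrk',
    natCast_modEq_neg_iff hr]
  constructor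
  · rintro ⟨⟨h1, h2, h3, h4, h5, h6⟩, hL⟩
    rw [hL] at h3 h4 h5 h6
    refine ⟨fun i hi ↦ ?_, fun i hi ↦ ?_⟩
    · rw [Finset.mem_union, mem_multiples, mem_distinctParts hrk']
      rcases h1 i hi with h | ⟨t, rfl⟩
      · right
        rcases (congrPM_iff hr hrk').1 h with ⟨j, hj⟩ | ⟨j, hj⟩
        · refine .inl ⟨j, ?_, hj⟩
          have := h5 i hi ⟨j, hj⟩
          by_contra! hm
          have : (2 * m - 1) * k ≤ (2 * j) * k := Nat.mul_le_mul_right _ (by omega)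
          nlinarith
        · refine .inr ⟨j, ?_, hj⟩
          have := h6 i hi ⟨j, hj⟩
          by_contra! hm
          have : (2 * m - 1) * k ≤ (2 * j) * k := Nat.mul_le_mul_right _ (by omega)
          nlinarith
      · left
        have ht : 0 < t := Nat.pos_of_ne_zero fun h ↦ (p.parts_pos hi).ne (by simp [h])
        refine ⟨t - 1, ?_, by rw [Nat.sub_add_cancel ht, mul_comm]⟩
        rcases Nat.even_or_odd' t with ⟨s, rfl | rfl⟩
        · have := h4 _ hi ((isEvenMultiple_iff hk).2 ⟨s, mul_comm _ _⟩)
          -- At m = 0 truncation makes the right side 1, not 2m; s > 0 still excludes this case.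
          have : 2 * s ≤ 2 * m - 1 + 1 := by
            refine Nat.le_of_mul_le_mul_right (c := k) ?_ hk
            linarith
          omega
        · have := le_largestOddMultiple hi ((isOddMultiple_iff hk).2 ⟨s, mul_comm _ _⟩)
          rw [hL, mul_comm] at this
          have := Nat.le_of_mul_le_mul_right this hk
          omega
    · split_ifs with hd
      · intro ho
        refine Multiset.one_le_count_iff_mem.2 (h3 i ?_ ho)
        rcases Finset.mem_union.1 hi with h | h
        · obtain ⟨t, ht, hit⟩ := mem_multiples.1 h
          obtain ⟨s, rfl⟩ := (isOddMultiple_iff hk).1 ho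
          have := Nat.eq_of_mul_eq_mul_right hk hit
          exact Nat.mul_le_mul_right _ (by omega)
        · exact absurd hd (congrPM_of_mem_distinctParts hr hrk' h |>.not_dvd hr hrk')
      · by_cases hp : i ∈ p.parts
        · exact (h2 i hp ((h1 i hp).resolve_right hd)).le
        · simp [Multiset.count_eq_zero.2 hp]
  · rintro ⟨h1, h2⟩
    have hmul : ∀ i ∈ p.parts, k ∣ i → ∃ t < 2 * m, i = (t + 1) * k := by
      intro i hi hd
      rcases Finset.mem_union.1 (h1 i hi) with h | h
      · exact mem_multiples.1 h
      · exact absurd hd (congrPM_of_mem_distinctParts hr hrk' h |>.not_dvd hr hrk')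
    have hdist : ∀ i ∈ p.parts, CongrPM k r i →
        (∃ t < m, i = t * k + r) ∨ ∃ t < m, i + r = (t + 1) * k := by
      intro i hi hc
      rcases Finset.mem_union.1 (h1 i hi) with h | h
      · obtain ⟨t, -, rfl⟩ := mem_multiples.1 h
        exact absurd (Dvd.intro_left _ rfl) (hc.not_dvd hr hrk')
      · exact (mem_distinctParts hrk').1 h
    have hodd : ∀ i, i ≤ (2 * m - 1) * k → IsOddMultiple k i → i ∈ p.parts := by
      intro i hi ho
      obtain ⟨t, rfl⟩ := (isOddMultiple_iff hk).1 ho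
      have := Nat.le_of_mul_le_mul_right hi hk
      have := h2 _ (Finset.mem_union_left _ (mem_multiples.2 ⟨2 * t, by omega, rfl⟩))
      rw [if_pos (Dvd.intro_left _ rfl)] at this
      exact Multiset.one_le_count_iff_mem.1 (this ho)
    have hL : largestOddMultiple k p = (2 * m - 1) * k := by
      refine largestOddMultiple_eq (fun i hi ho ↦ ?_) ?_
      · obtain ⟨t, ht, hit⟩ := hmul i hi ho.1
        obtain ⟨s, rfl⟩ := (isOddMultiple_iff hk).1 ho
        have := Nat.eq_of_mul_eq_mul_right hk hit
        exact Nat.mul_le_mul_right _ (by omega)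
      · obtain _ | m := m
        · simp
        · have ho : IsOddMultiple k ((2 * (m + 1) - 1) * k) := (isOddMultiple_iff hk).2 ⟨m, rfl⟩
          exact .inr ⟨hodd _ le_rfl ho, ho⟩
    have hbound : ∀ t < m, (2 * t + 1) * k ≤ (2 * m - 1) * k := fun t ht ↦
      Nat.mul_le_mul_right _ (by omega)
    refine ⟨?_, hL⟩
    rw [hL]
    refine ⟨fun i hi ↦ ?_, fun i hi hc ↦ ?_, hodd, fun i hi he ↦ ?_, ?_, ?_⟩
    · rcases Finset.mem_union.1 (h1 i hi) with h | h
      · obtain ⟨t, -, rfl⟩ := mem_multiples.1 h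
        exact .inr (Dvd.intro_left _ rfl)
      · exact .inl (congrPM_of_mem_distinctParts hr hrk' h)
    · have := h2 i (h1 i hi)
      rw [if_neg (hc.not_dvd hr hrk')] at this
      exact le_antisymm this (Multiset.one_le_count_iff_mem.2 hi)
    · obtain ⟨t, ht, rfl⟩ := hmul i hi he.1
      rw [← Nat.succ_mul]
      exact Nat.mul_le_mul_right _ (by omega)
    · rintro i hi ⟨j, hj⟩
      rcases hdist i hi ((congrPM_iff hr hrk').2 (.inl ⟨j, hj⟩)) with ⟨t, ht, h⟩ | ⟨t, ht, h⟩
      · nlinarith [hbound t ht]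
      · exact absurd (by omega) (mul_add_ne_mul_sub hr hrk' hrk.ne j t)
    · rintro i hi ⟨j, hj⟩
      rcases hdist i hi ((congrPM_iff hr hrk').2 (.inr ⟨j, hj⟩)) with ⟨t, ht, h⟩ | ⟨t, ht, h⟩
      · exact absurd (by omega) (mul_add_ne_mul_sub hr hrk' hrk.ne t j)
      · nlinarith [hbound t ht]

/-- The exponent is k(1 + 3 + … + (2m-1)), from the compulsory copies of the odd multiples. -/
theorem prod_multiples {k : ℕ} (hk : 0 < k) (m : ℕ) :
    ∏ i ∈ multiples k (2 * m), (PowerSeries.mk fun d ↦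
        if i ∣ d ∧ (IsOddMultiple k i → 1 ≤ d / i) then 1 else 0 : ℤ⟦X⟧) =
      X ^ (k * m ^ 2) * invPoch k (2 * m) := by
  rw [multiples, Finset.prod_image fun a _ b _ h ↦ by
    simpa using Nat.eq_of_mul_eq_mul_right hk h]
  induction m with
  | zero => simp [invPoch]
  | succ m ih =>
    have ho : IsOddMultiple k ((2 * m + 1) * k) := (isOddMultiple_iff hk).2 ⟨m, rfl⟩
    have he : ¬ IsOddMultiple k ((2 * m + 1 + 1) * k) := by
      rw [isOddMultiple_iff hk]
      rintro ⟨t, ht⟩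
      have := Nat.eq_of_mul_eq_mul_right hk ht
      omega
    rw [show 2 * (m + 1) = 2 * m + 1 + 1 by ring, Finset.prod_range_succ, Finset.prod_range_succ,
      ih]
    simp only [ho, he, forall_const, false_imp_iff, and_true]
    rw [mk_dvd_and_one_le (by positivity), ← geomSeries]
    simp only [invPoch, Finset.prod_range_succ]
    ring

theorem card_isTypeA_and_eq_coeff {k r : ℕ} (hr : 0 < r) (hrk : 2 * r < k) (n m : ℕ) :
    ((Finset.univ.filter fun p : n.Partition ↦
        IsTypeA k r p ∧ largestOddMultiple k p = (2 * m - 1) * k).card : ℤ) =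
      coeff n (X ^ (k * m ^ 2) * invPoch k (2 * m) * distinctProd k r m) := by
  have hk : 0 < k := by omega
  have hrk' : r < k := by omega
  have hM : ∀ i ∈ multiples k (2 * m), k ∣ i := by
    intro i hi
    obtain ⟨t, -, rfl⟩ := mem_multiples.1 hi
    exact Dvd.intro_left _ rfl
  have hD : ∀ i ∈ distinctParts k r m, ¬ k ∣ i := fun i hi ↦
    (congrPM_of_mem_distinctParts hr hrk' hi).not_dvd hr hrk'
  have hdisj : Disjoint (multiples k (2 * m)) (distinctParts k r m) :=
    Finset.disjoint_left.2 fun i h1 h2 ↦ hD i h2 (hM i h1)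
  have hS : 0 ∉ multiples k (2 * m) ∪ distinctParts k r m := by
    intro h
    rcases Finset.mem_union.1 h with h | h
    · obtain ⟨t, -, h⟩ := mem_multiples.1 h
      have : 0 < (t + 1) * k := by positivity
      omega
    · exact (pos_of_mem_distinctParts hr hrk' h).ne rfl
  simp only [isTypeA_and_iff hr hrk]
  rw [card_partition_eq_coeff hS
    (fun i c ↦ if k ∣ i then IsOddMultiple k i → 1 ≤ c else c ≤ 1) n, Finset.prod_union hdisj,
    prod_distinctParts_mk hr hrk' hrk.ne m
      (fun i c ↦ if k ∣ i then IsOddMultiple k i → 1 ≤ c else c ≤ 1)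
      (fun i hi d ↦ by simp [hD i hi]),
    ← prod_multiples hk]
  congr 2
  refine Finset.prod_congr rfl fun i hi ↦ ?_
  simp only [hM i hi, if_true]

/-! ### Classification by the largest odd multiple and conclusion -/

theorem countA_eq_sum {k : ℕ} (hk : 0 < k) (r n : ℕ) :
    countA k r n = ∑ m ∈ Finset.range (n + 1), (Finset.univ.filter fun p : n.Partition ↦
      IsTypeA k r p ∧ largestOddMultiple k p = (2 * m - 1) * k).card := by
  rw [← Finset.card_biUnion, countA]
  · congr 1
    ext p
    simp only [Finset.mem_filter, Finset.mem_univ, true_and, Finset.mem_biUnion, Finset.mem_range]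
    refine ⟨fun h ↦ ?_, fun ⟨m, _, h, _⟩ ↦ h⟩
    rcases largestOddMultiple_eq_zero_or_mem k p with h0 | ⟨hmem, ho⟩
    · exact ⟨0, by omega, h, by simpa using h0⟩
    · obtain ⟨t, ht⟩ := (isOddMultiple_iff hk).1 ho
      have hle := Multiset.single_le_sum (fun _ _ ↦ Nat.zero_le _) _ hmem
      rw [p.parts_sum, ht] at hle
      have := Nat.le_mul_of_pos_right (2 * t + 1) hk
      exact ⟨t + 1, by omega, h, ht⟩
  · intro a _ b _ hab
    refine Finset.disjoint_left.2 fun p h1 h2 ↦ ?_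
    have h1 := (Finset.mem_filter.1 h1).2.2
    have h2 := (Finset.mem_filter.1 h2).2.2
    -- Even with truncation, 2m - 1 takes the distinct values 0, 1, 3, 5, ….
    have := Nat.eq_of_mul_eq_mul_right hk (h1.symm.trans h2)
    omega

theorem countA_eq_countB {k r : ℕ} (hr : 0 < r) (hrk : 2 * r < k) (n : ℕ) :
    countA k r n = countB k r n := by
  have hk : 0 < k := by omega
  have h := X_pow_dvd_iff.1 (X_pow_dvd_sum_sub_prod hk (show r ≤ k by omega) n) n n.lt_succ_self
  rw [map_sub, sub_eq_zero, map_sum, ← countB_eq_coeff hr hrk le_rfl] at h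
  simp only [← card_isTypeA_and_eq_coeff hr hrk] at h
  rw [countA_eq_sum hk]
  exact_mod_cast h

end MainTheorem

theorem mainTheorem11 (k r : ℕ) (hk : 3 ≤ k) (hr : 0 < r) (hrk : (r : ℚ) < (k : ℚ) / 2)
    (n : ℕ) (hn : 1 ≤ n) : countA k r n = countB k r n :=
  countA_eq_countB hr (ratCast_lt_half_iff.1 hrk) n
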